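/- Let $\mathfrak f_{s,r}$ be the free nilpotent real Lie algebra of step $s$ and rank $r$, and let $n=\dim\mathfrak f_{s,r}$. A \emph{Hall basis} $X_1,\dots,X_n$ of $\mathfrak f_{s,r}$, with degrees $d(1),\dots,d(n)\in\{1,\dots,s\}$, is constructed as follows. The elements $X_1,\dots,X_r$ are a basis of the first layer (the span of the free generators) and have degree $1$. For $2\le d\le s$, the elements of degree $d$ are the commutators $[X_i,X_j]$ of already constructed elements with $i>j$, $d(i)+d(j)=d$, and such that if $X_i$ was constructed as $[X_h,X_k]$ then $k\le j$; each such commutator is listed once. The elements are numbered so that $d(i)<d(j)$ implies $i<j$. Following this construction, every $X_\ell$ is written as $X_\ell=[\cdots[[X_{\ell_0},X_{\ell_1}],X_{\ell_2}],\dots,X_{\ell_h}]$ with $\ell_0\in\{1,\dots,r\}$ and $h\ge 0$, by repeatedly decomposing the left factor of the commutator until a generator is reached. Define the multi-index $I(\ell)\in\mathbb N^n$ by $I(\ell)_j=\#\{m\ge 1:\ell_m=j\}$. Write $j\prec \ell$ if $X_j=[\cdots[X_{\ell_0},X_{\ell_1}],\dots,X_{\ell_k}]$ for some $0\le k\le h$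 (so that $\ell\prec\ell$). Given a Hall basis of $\mathfrak f_{s,r}$, the associated \emph{Hall--Grayson--Grossman basis} of vector fields $X_1,\dots,X_n$ on $\mathbb R^n$ is defined by $$X_i(x)=\sum_{\ell\,:\,i\prec\ell}\frac{(-1)^{|I(\ell)|}}{I(\ell)!}\,x^{I(\ell)}\,\frac{\partial}{\partial x_\ell},\qquad i=1,\dots,r,$$ and, for $i>r$, by $X_i=[X_j,X_k]$ (Lie bracket of vector fields) whenever the $i$-th element of the Hall basis was constructed as the commutator of its $j$-th and $k$-th elements. \textbf{Proposition.} Let $X_1,\dots,X_n$ be a Hall--Grayson--Grossman basis of vector fields on $\mathbb R^n$, and let $e^{tX}$ denote the flow of the vector field $X$ at time $t$. Then for every $x\in\mathbb R^n$ the point $$\Psi(x)=e^{x_1X_1}\circ\cdots\circ e^{x_nX_n}(0)$$ is well defined (all the integral curves involved exist up to the required times, with unique values there) and $\Psi(x)=x$. That is, the standard coordinates of $\mathbb R^n$ are exponential coordinates of the second type associated with $X_1,\dots,X_n$. -/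

import Mathlib

/-- The free nilpotent real Lie algebra of step `s` and rank `r`: the free Lie algebra on `r`
generators modulo all iterated brackets of length `s + 1`. -/
abbrev FreeNilpotentLieAlgebra (s r : ℕ) : Type :=
  FreeLieAlgebra ℝ (Fin r) ⧸
    LieModule.lowerCentralSeries ℝ (FreeLieAlgebra ℝ (Fin r)) (FreeLieAlgebra ℝ (Fin r)) s

/-- The first layer of the free nilpotent Lie algebra: the span of the free generators. -/
noncomputable def FreeNilpotentLieAlgebra.firstLayer (s r : ℕ) :
    Submodule ℝ (FreeNilpotentLieAlgebra s r) :=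
  Submodule.span ℝ (Set.range fun i : Fin r ↦
    LieSubmodule.Quotient.mk
      (N := LieModule.lowerCentralSeries ℝ (FreeLieAlgebra ℝ (Fin r))
        (FreeLieAlgebra ℝ (Fin r)) s)
      (FreeLieAlgebra.of ℝ i))

/-- A Hall basis `X₁, …, Xₙ` of the free nilpotent Lie algebra of step `s` and rank `r`, as it
is produced by M. Hall's algorithm (indices start at `0` here). The genealogy of the basis is
part of the data: `origin i = none` when `Xᵢ` is one of the generators, and
`origin i = some (j, k)` when `Xᵢ` was constructed as `[Xⱼ, Xₖ]`. That the elements form a basis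
of the Lie algebra is M. Hall's theorem and is not assumed. -/
structure HallBasis (s r n : ℕ) where
  /-- The elements of the basis. -/
  elem : Fin n → FreeNilpotentLieAlgebra s r
  /-- The degrees of the elements. -/
  deg : Fin n → ℕ
  /-- The way in which each element was constructed. -/
  origin : Fin n → Option (Fin n × Fin n)
  rank_le : r ≤ n
  one_le_deg : ∀ i, 1 ≤ deg i
  deg_le : ∀ i, deg i ≤ s
  /-- The elements are ordered compatibly with the degree. -/
  lt_of_deg_lt : ∀ i j, deg i < deg j → i < j
  /-- The generators are the first `r` elements. -/
  origin_eq_none_iff : ∀ i, origin i = none ↔ i.val < r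
  deg_generator : ∀ i, origin i = none → deg i = 1
  /-- The generators are a basis of the first layer. -/
  linearIndependent_generators :
    LinearIndependent ℝ fun i : Fin r ↦ elem (Fin.castLE rank_le i)
  span_generators :
    Submodule.span ℝ (Set.range fun i : Fin r ↦ elem (Fin.castLE rank_le i)) =
      FreeNilpotentLieAlgebra.firstLayer s r
  elem_eq : ∀ i j k, origin i = some (j, k) → elem i = ⁅elem j, elem k⁆
  deg_eq : ∀ i j k, origin i = some (j, k) → deg i = deg j + deg k
  /-- If `[Xⱼ, Xₖ]` is an element of the basis, then `j > k`. -/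
  lt_of_origin : ∀ i j k, origin i = some (j, k) → k < j
  /-- If `[Xⱼ, Xₖ]` is an element of the basis and `Xⱼ` was constructed as `[Xₕ, Xₗ]`, then
  `l ≤ k`. -/
  le_of_origin : ∀ i j k, origin i = some (j, k) →
    ∀ h l, origin j = some (h, l) → l ≤ k
  /-- Every commutator of degree at most `s` that satisfies the two preceding conditions is an
  element of the basis, and it is listed once. -/
  existsUnique_origin : ∀ j k, deg j + deg k ≤ s → k < j →
    (∀ h l, origin j = some (h, l) → l ≤ k) → ∃! i, origin i = some (j, k)

namespace HallBasis

variable {s r n : ℕ} (H : HallBasis s r n)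

theorem left_lt {i j k : Fin n} (h : H.origin i = some (j, k)) : j < i := by
  apply H.lt_of_deg_lt
  have h1 := H.deg_eq i j k h
  have h2 := H.one_le_deg k
  omega

/-- The string of indices `ℓ₀, ℓ₁, …, ℓₕ` with
`X_ℓ = [⋯[[X_{ℓ₀}, X_{ℓ₁}], X_{ℓ₂}], …, X_{ℓₕ}]`, where `X_{ℓ₀}` is a generator. -/
def string (i : Fin n) : List (Fin n) :=
  match h : H.origin i with
  | none => [i]
  | some (j, k) =>
    have : j < i := H.left_lt h
    string j ++ [k]
termination_by i

theorem string_of_none {i : Fin n} (h : H.origin i = none) : H.string i = [i] := by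
  rw [string]
  split <;> simp_all

theorem string_of_some {i j k : Fin n} (h : H.origin i = some (j, k)) :
    H.string i = H.string j ++ [k] := by
  rw [string]
  split <;> simp_all

/-- The multi-index `I(ℓ)`, with `I(ℓ)ⱼ = #{m ≥ 1 : ℓₘ = j}`. -/
def multiIndex (l j : Fin n) : ℕ :=
  (H.string l).tail.count j

/-- `H.Prec j ℓ` (written `j ≺ ℓ`): `X_ℓ = [X_{ℓ₀}, …, X_{ℓₕ}]` is a direct descendant of `Xⱼ`,
that is, `Xⱼ = [X_{ℓ₀}, …, X_{ℓₖ}]` for some `k ≤ h`. -/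
def Prec (j l : Fin n) : Prop :=
  H.string j <+: H.string l

open Classical in
/-- The Grayson–Grossman vector field
`Xᵢ(x) = ∑_{ℓ : i ≺ ℓ} ((-1)^{|I(ℓ)|} / I(ℓ)!) x^{I(ℓ)} ∂/∂x_ℓ` on `ℝⁿ`. -/
noncomputable def graysonGrossmanField (i : Fin n) (x : Fin n → ℝ) : Fin n → ℝ := fun l ↦
  if H.Prec i l then
    (-1) ^ (∑ j, H.multiIndex l j) / (∏ j, ((H.multiIndex l j).factorial : ℝ)) *
      ∏ j, x j ^ H.multiIndex l j
  else 0

end HallBasis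

/-- `X₁, …, Xₙ` is a Hall–Grayson–Grossman basis of vector fields on `ℝⁿ` for the free nilpotent
Lie algebra of step `s` and rank `r`: for some Hall basis of that Lie algebra, `X₁, …, Xᵣ` are
the Grayson–Grossman vector fields, and they are completed to `X₁, …, Xₙ` by Hall's construction,
with the Lie bracket of vector fields. -/
def IsHallGraysonGrossmanBasis (s r : ℕ) {n : ℕ} (X : Fin n → (Fin n → ℝ) → (Fin n → ℝ)) :
    Prop :=
  ∃ H : HallBasis s r n,
    (∀ i, H.origin i = none → X i = H.graysonGrossmanField i) ∧
    ∀ i j k, H.origin i = some (j, k) → X i = VectorField.lieBracket ℝ (X j) (X k)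

/-- The point `q` is reached at time `t` by an integral curve of the vector field `V` that is
defined between the times `0` and `t` and is at `p` at time `0`. -/
def FlowsTo {n : ℕ} (V : (Fin n → ℝ) → (Fin n → ℝ)) (t : ℝ) (p q : Fin n → ℝ) : Prop :=
  ∃ γ : ℝ → Fin n → ℝ,
    IsIntegralCurveOn γ (fun _ ↦ V) (Set.uIcc 0 t) ∧ γ 0 = p ∧ γ t = q

/-- The flow `e^{tV}` of the vector field `V`, as a partial map: `e^{tV}(p)` is defined when an
integral curve starting at `p` exists up to time `t` and its value at `t` is unique. -/
noncomputable def vectorFieldFlow {n : ℕ} (V : (Fin n → ℝ) → (Fin n → ℝ)) (t : ℝ)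
    (p : Fin n → ℝ) : Part (Fin n → ℝ) where
  Dom := ∃! q, FlowsTo V t p q
  get h := h.exists.choose

/-- The exponential mapping of the second type `Ψ(x) = (e^{x₁X₁} ∘ ⋯ ∘ e^{xₙXₙ})(0)`, as a
partial map. -/
noncomputable def secondTypeExp {n : ℕ} (X : Fin n → (Fin n → ℝ) → (Fin n → ℝ))
    (x : Fin n → ℝ) : Part (Fin n → ℝ) :=
  Fin.foldr n (fun i P ↦ P.bind (vectorFieldFlow (X i) (x i))) (Part.some 0)

/-! ### Combinatorics of Hall strings. -/

namespace HallBasis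

variable {s r n : ℕ} (H : HallBasis s r n)

/-! Everything rests on `apply_eq_single`: where the coordinates before the `i`-th vanish, `Xᵢ` is
`∂/∂xᵢ`. The flows act in the order `n, …, 1`, so when `Xᵢ` acts the current point has zero
coordinates up to `i`. Its integral curve is then a straight line that fills in the `i`-th
coordinate with `xᵢ`.

For `Xᵢ = [Xⱼ, Xₖ]`, restrict to the points whose coordinates before `k` vanish. By induction `Xₖ =
∂/∂xₖ` there, and `Xⱼ` is tangent to this set since its components before `j > k` are zero. So the
bracket is `-∂Xⱼ/∂xₖ`, and `Xᵢ` is the field of its generator differentiated, up to sign, along the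
multi-index of `i` (`apply_eq_derivedField`).

When all coordinates before `i` vanish, a component `ℓ` survives only if its string is that of `i`
followed by letters `≥ i`. Hall's condition `k < j` forbids such letters, so `ℓ = i`
(`eq_of_multiIndex_eq_of_lt`). -/

theorem origin_injective {i i' j k : Fin n} (h : H.origin i = some (j, k))
    (h' : H.origin i' = some (j, k)) : i = i' :=
  (H.existsUnique_origin j k (H.deg_eq i j k h ▸ H.deg_le i) (H.lt_of_origin i j k h)
    (H.le_of_origin i j k h)).unique h h'

theorem string_ne_nil (i : Fin n) : H.string i ≠ [] := by
  cases h : H.origin i with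
  | none => simp [H.string_of_none h]
  | some p => simp [H.string_of_some h]

theorem tail_string_of_some {i j k : Fin n} (h : H.origin i = some (j, k)) :
    (H.string i).tail = (H.string j).tail ++ [k] := by
  rw [H.string_of_some h, List.tail_append_of_ne_nil (H.string_ne_nil j)]

theorem head?_string_of_some {i j k : Fin n} (h : H.origin i = some (j, k)) :
    (H.string i).head? = (H.string j).head? := by
  rw [H.string_of_some h, List.head?_append_of_ne_nil _ (H.string_ne_nil j)]

theorem string_injective : Function.Injective H.string := by
  intro i
  induction i using WellFoundedLT.induction with
  | ind i ih =>
    intro l hil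
    have hlen := congrArg List.length hil
    cases hi : H.origin i with
    | none =>
      cases hl : H.origin l with
      | none => simpa [H.string_of_none hi, H.string_of_none hl] using hil
      | some p =>
        simp [H.string_of_none hi, H.string_of_some hl, H.string_ne_nil] at hlen
    | some p =>
      cases hl : H.origin l with
      | none =>
        simp [H.string_of_some hi, H.string_of_none hl, H.string_ne_nil] at hlen
      | some q =>
        obtain ⟨j, k⟩ := p
        obtain ⟨j', k'⟩ := q
        rw [H.string_of_some hi, H.string_of_some hl] at hil
        obtain ⟨hj, hk⟩ := List.append_inj' hil rfl
        obtain rfl := ih j (H.left_lt hi) hj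
        obtain rfl : k = k' := by simpa using hk
        exact H.origin_injective hi hl

/-- Every nonempty prefix of the string of an element is the string of an element. -/
theorem exists_string_eq_of_prefix {l : Fin n} {u : List (Fin n)} (hu : u ≠ [])
    (h : u <+: H.string l) : ∃ i, H.string i = u := by
  induction l using WellFoundedLT.induction with
  | ind l ih =>
    cases hl : H.origin l with
    | none =>
      refine ⟨l, ?_⟩
      rw [H.string_of_none hl] at h ⊢
      rcases List.prefix_cons_iff.1 h with h | ⟨t, rfl, ht⟩
      · exact absurd h hu
      · simp [List.prefix_nil.1 ht]
    | some p =>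
      obtain ⟨j, k⟩ := p
      rw [H.string_of_some hl] at h
      rcases List.prefix_concat_iff.1 h with h | h
      · exact ⟨l, by rw [H.string_of_some hl, h]⟩
      · exact ih j (H.left_lt hl) h

/-- If the string of `i` is followed by `m` in the string of some element, then `[Xᵢ, Xₘ]` is an
element of the basis. -/
theorem exists_origin_of_prefix {i l m : Fin n} (h : H.string i ++ [m] <+: H.string l) :
    ∃ i', H.origin i' = some (i, m) := by
  obtain ⟨i', hi'⟩ := H.exists_string_eq_of_prefix (by simp) h
  refine ⟨i', ?_⟩
  cases ho : H.origin i' with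
  | none =>
    have := congrArg List.length hi'
    simp [H.string_of_none ho, H.string_ne_nil] at this
  | some p =>
    obtain ⟨j, k⟩ := p
    rw [H.string_of_some ho] at hi'
    obtain ⟨hj, hk⟩ := List.append_inj' hi' rfl
    obtain rfl := H.string_injective hj
    simpa using hk

/-- Hall's condition `l ≤ k` makes the right factors nondecreasing along the genealogy, so the last
one is the largest. -/
theorem le_of_mem_tail_string {i j k m : Fin n} (h : H.origin i = some (j, k))
    (hm : m ∈ (H.string i).tail) : m ≤ k := by
  induction i using WellFoundedLT.induction generalizing j k with
  | ind i ih =>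
    rw [H.tail_string_of_some h, List.mem_append, List.mem_singleton] at hm
    rcases hm with hm | rfl
    · cases hj : H.origin j with
      | none => simp [H.string_of_none hj] at hm
      | some p => exact (ih j (H.left_lt h) hj hm).trans (H.le_of_origin i j k h _ _ hj)
    · exact le_rfl

theorem lt_of_mem_tail_string {i m : Fin n} (hm : m ∈ (H.string i).tail) : m < i := by
  cases h : H.origin i with
  | none => simp [H.string_of_none h] at hm
  | some p =>
    exact (H.le_of_mem_tail_string h hm).trans_lt
      ((H.lt_of_origin i p.1 p.2 h).trans (H.left_lt h))

/-- Sortedness is what allows a string to be recovered from mere letter counts. -/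
theorem pairwise_tail_string (i : Fin n) : (H.string i).tail.Pairwise (· ≤ ·) := by
  induction i using WellFoundedLT.induction with
  | ind i ih =>
    cases h : H.origin i with
    | none => simp [H.string_of_none h]
    | some p =>
      obtain ⟨j, k⟩ := p
      rw [H.tail_string_of_some h, List.pairwise_append]
      refine ⟨ih j (H.left_lt h), by simp, fun a ha b hb ↦ ?_⟩
      rw [List.mem_singleton.1 hb]
      exact H.le_of_mem_tail_string h (by simp [H.tail_string_of_some h, ha])

theorem string_eq_of_head?_eq {i l : Fin n} {u : List (Fin n)}
    (hh : (H.string l).head? = (H.string i).head?)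
    (ht : (H.string l).tail = (H.string i).tail ++ u) : H.string l = H.string i ++ u := by
  obtain ⟨a, v, hi⟩ := List.exists_cons_of_ne_nil (H.string_ne_nil i)
  obtain ⟨b, w, hl⟩ := List.exists_cons_of_ne_nil (H.string_ne_nil l)
  simp_all

/-- The string of an element is determined by its generator and its multi-index. -/
theorem eq_of_tail_perm {i l : Fin n} (hh : (H.string l).head? = (H.string i).head?)
    (hp : (H.string l).tail.Perm (H.string i).tail) : l = i := by
  have := List.Perm.eq_of_pairwise' (H.pairwise_tail_string l) (H.pairwise_tail_string i) hp
  exact H.string_injective <| by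
    simpa using H.string_eq_of_head?_eq (u := []) hh (by simpa using this)

theorem deg_eq_sum (i : Fin n) : H.deg i = ((H.string i).map H.deg).sum := by
  induction i using WellFoundedLT.induction with
  | ind i ih =>
    cases h : H.origin i with
    | none => simp [H.string_of_none h]
    | some p => simp [H.string_of_some h, H.deg_eq i p.1 p.2 h, ih p.1 (H.left_lt h)]

theorem exists_tail_perm_append {i l : Fin n} (h : ∀ m, H.multiIndex i m ≤ H.multiIndex l m) :
    ∃ u, (H.string l).tail.Perm ((H.string i).tail ++ u) := by
  have hle : ((H.string i).tail : Multiset (Fin n)) ≤ ((H.string l).tail : Multiset (Fin n)) :=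
    Multiset.le_iff_count.2 fun m ↦ by simpa [multiIndex] using h m
  obtain ⟨u, hu⟩ := Multiset.le_iff_exists_add.1 hle
  induction u using Quotient.inductionOn with
  | h u => exact ⟨u, Multiset.coe_eq_coe.1 (by simpa using hu)⟩

/-- An element with the same generator and a larger multi-index comes later in the basis. -/
theorem le_of_multiIndex_le {i l : Fin n} (hh : (H.string l).head? = (H.string i).head?)
    (h : ∀ m, H.multiIndex i m ≤ H.multiIndex l m) : i ≤ l := by
  obtain ⟨u, hu⟩ := H.exists_tail_perm_append h
  rcases u with _ | ⟨a, u⟩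
  · exact (H.eq_of_tail_perm hh (by simpa using hu)).ge
  -- The generators agree, and each surplus letter adds at least `1` to the degree.
  · refine (H.lt_of_deg_lt i l ?_).le
    obtain ⟨b, v, hi⟩ := List.exists_cons_of_ne_nil (H.string_ne_nil i)
    obtain ⟨c, w, hl⟩ := List.exists_cons_of_ne_nil (H.string_ne_nil l)
    rw [H.deg_eq_sum i, H.deg_eq_sum l]
    have hs := (hu.map H.deg).sum_eq
    have ha := H.one_le_deg a
    simp_all
    omega

/-- An element `ℓ` with the same generator as `i`, whose multi-index exceeds that of `i` only in
places which are at least `i`, is equal to `i`. -/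
theorem eq_of_multiIndex_eq_of_lt {i l : Fin n} (hh : (H.string l).head? = (H.string i).head?)
    (h : ∀ m, H.multiIndex i m ≤ H.multiIndex l m)
    (hlt : ∀ m < i, H.multiIndex l m = H.multiIndex i m) : l = i := by
  obtain ⟨u, hu⟩ := H.exists_tail_perm_append h
  have hui : ∀ m ∈ u, i ≤ m := by
    intro m hm
    by_contra! hmi
    have h1 := hlt m hmi
    have h2 := hu.count_eq m
    have h3 := List.count_pos_iff.2 hm
    simp only [multiIndex, List.count_append] at h1 h2
    omega
  -- The tail of `i` has letters below `i` and the surplus has letters `≥ i`. Once the surplus is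
  -- sorted their concatenation is sorted, hence equals the tail of `l`.
  have hperm := (u.mergeSort_perm (· ≤ ·))
  have hsort : (u.mergeSort (· ≤ ·)).Pairwise (· ≤ ·) := u.pairwise_mergeSort' (· ≤ ·)
  generalize u.mergeSort (· ≤ ·) = v at hperm hsort
  have hvi : ∀ m ∈ v, i ≤ m := fun m hm ↦ hui m (hperm.mem_iff.1 hm)
  have hpair : ((H.string i).tail ++ v).Pairwise (· ≤ ·) :=
    List.pairwise_append.2 ⟨H.pairwise_tail_string i, hsort, fun a ha b hb ↦
      (H.lt_of_mem_tail_string ha).le.trans (hvi b hb)⟩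
  have htail := List.Perm.eq_of_pairwise' (H.pairwise_tail_string l) hpair
    (hu.trans (hperm.symm.append_left _))
  have hstr := H.string_eq_of_head?_eq hh htail
  rcases v with _ | ⟨m, v⟩
  · exact H.string_injective (by simpa using hstr)
  -- A first surplus letter `m` would make `[Xᵢ, Xₘ]` a basis element, forcing `m < i`.
  · obtain ⟨i', hi'⟩ := H.exists_origin_of_prefix (i := i) (l := l) (m := m) ⟨v, by simp [hstr]⟩
    exact absurd (H.lt_of_origin i' i m hi') (hvi m (by simp)).not_gt

theorem prec_iff_of_none {i l : Fin n} (h : H.origin i = none) :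
    H.Prec i l ↔ (H.string l).head? = (H.string i).head? := by
  obtain ⟨c, w, hl⟩ := List.exists_cons_of_ne_nil (H.string_ne_nil l)
  simp [Prec, H.string_of_none h, hl, eq_comm]

theorem multiIndex_of_none {i : Fin n} (h : H.origin i = none) (m : Fin n) :
    H.multiIndex i m = 0 := by
  simp [multiIndex, H.string_of_none h]

theorem multiIndex_of_some {i j k : Fin n} (h : H.origin i = some (j, k)) (m : Fin n) :
    H.multiIndex i m = H.multiIndex j m + if m = k then 1 else 0 := by
  rcases eq_or_ne m k with rfl | hm
  · simp [multiIndex, H.tail_string_of_some h]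
  · simp [multiIndex, H.tail_string_of_some h, hm, hm.symm]

end HallBasis

/-! ### Signed divided powers. -/

/-- The `b`-th derivative of `(-1) ^ a * y ^ a / a!`, up to the sign `(-1) ^ b`. -/
noncomputable def signedDividedPow (a b : ℕ) (y : ℝ) : ℝ :=
  if b ≤ a then (-1) ^ (a - b) * y ^ (a - b) / (a - b).factorial else 0

theorem signedDividedPow_self (a : ℕ) (y : ℝ) : signedDividedPow a a y = 1 := by
  simp [signedDividedPow]

theorem signedDividedPow_zero_right (a b : ℕ) :
    signedDividedPow a b 0 = if a = b then 1 else 0 := by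
  unfold signedDividedPow
  rcases lt_trichotomy a b with h | rfl | h
  · simp [h.ne, h.not_ge]
  · simp
  · simp [h.ne', h.le, (Nat.sub_pos_of_lt h).ne']

theorem hasDerivAt_signedDividedPow (a b : ℕ) (y : ℝ) :
    HasDerivAt (signedDividedPow a b) (-signedDividedPow a (b + 1) y) y := by
  rcases lt_or_ge b a with h | h
  · obtain ⟨c, rfl⟩ := Nat.exists_eq_add_of_lt h
    have h1 : signedDividedPow (b + c + 1) b =
        fun y ↦ (-1) ^ (c + 1) * y ^ (c + 1) / ((c + 1).factorial : ℝ) := by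
      funext y
      simp [signedDividedPow, show b + c + 1 - b = c + 1 by omega, show b ≤ b + c + 1 by omega]
    have h2 : signedDividedPow (b + c + 1) (b + 1) y = (-1) ^ c * y ^ c / (c.factorial : ℝ) := by
      simp [signedDividedPow, show b + c + 1 - (b + 1) = c by omega]
    rw [h1, h2]
    refine (((hasDerivAt_pow (c + 1) y).const_mul ((-1) ^ (c + 1))).div_const _).congr_deriv ?_
    rw [Nat.factorial_succ]
    have : (c.factorial : ℝ) ≠ 0 := by positivity
    push_cast
    field_simp
    simp [pow_succ, mul_comm]
  · have h1 : signedDividedPow a b = fun _ ↦ if b = a then 1 else 0 := by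
      funext y
      rcases h.eq_or_lt with rfl | h
      · simp [signedDividedPow]
      · simp [signedDividedPow, h.ne', h.not_ge]
    rw [h1, signedDividedPow, if_neg (Nat.lt_succ_of_le h).not_ge, neg_zero]
    exact hasDerivAt_const _ _

/-! ### Derived fields and their agreement with iterated brackets. -/

namespace HallBasis

variable {s r n : ℕ} (H : HallBasis s r n)

/-- The vector field obtained from the Grayson–Grossman field of the generator of `Xᵢ` by
differentiating along the coordinates in the multi-index of `i`. It agrees with `Xᵢ` where the
coordinates before the right parent of `Xᵢ` vanish. -/
noncomputable def derivedField (i : Fin n) (x : Fin n → ℝ) : Fin n → ℝ := fun l ↦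
  if (H.string l).head? = (H.string i).head? then
    ∏ m, signedDividedPow (H.multiIndex l m) (H.multiIndex i m) (x m)
  else 0

theorem graysonGrossmanField_eq_derivedField {i : Fin n} (h : H.origin i = none) :
    H.graysonGrossmanField i = H.derivedField i := by
  funext x l
  simp only [graysonGrossmanField, derivedField, H.prec_iff_of_none h, H.multiIndex_of_none h]
  congr 1
  simp [signedDividedPow, Finset.prod_div_distrib, Finset.prod_mul_distrib,
    Finset.prod_pow_eq_pow_sum]
  ring

theorem contDiff_graysonGrossmanField (i : Fin n) :
    ContDiff ℝ (⊤ : ℕ∞) (H.graysonGrossmanField i) := by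
  refine contDiff_pi.2 fun l ↦ ?_
  unfold graysonGrossmanField
  split_ifs <;> fun_prop

/-- A nonzero component needs the multi-index of `l` to dominate that of `i`, which forces `i ≤ l`.
-/
theorem derivedField_apply_eq_zero_of_lt {i l : Fin n} (h : l < i) (x : Fin n → ℝ) :
    H.derivedField i x l = 0 := by
  unfold derivedField
  split_ifs with hh
  · by_contra hne
    refine (H.le_of_multiIndex_le hh fun m ↦ ?_).not_gt h
    by_contra hm
    exact Finset.prod_ne_zero_iff.1 hne m (Finset.mem_univ m) (if_neg hm)
  · rfl

/-- At a zero coordinate a divided power survives only when fully differentiated, so a nonzero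
component has the multi-index of `i` at every place before `i`. -/
theorem derivedField_eq_single {i : Fin n} {x : Fin n → ℝ} (hx : ∀ m < i, x m = 0) :
    H.derivedField i x = Pi.single i 1 := by
  funext l
  rcases eq_or_ne l i with rfl | hli
  · simp [derivedField, signedDividedPow_self]
  · rw [Pi.single_eq_of_ne hli]
    unfold derivedField
    split_ifs with hh
    · by_contra hne
      rw [← ne_eq, Finset.prod_ne_zero_iff] at hne
      refine hli (H.eq_of_multiIndex_eq_of_lt hh (fun m ↦ ?_) fun m hm ↦ ?_)
      · by_contra hm
        exact hne m (Finset.mem_univ m) (if_neg hm)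
      · by_contra hml
        refine hne m (Finset.mem_univ m) ?_
        rw [hx m hm, signedDividedPow_zero_right, if_neg hml]
    · rfl

theorem hasDerivAt_derivedField {i j k : Fin n} (h : H.origin i = some (j, k)) (x : Fin n → ℝ) :
    HasDerivAt (fun t ↦ H.derivedField j (Function.update x k t)) (-H.derivedField i x) (x k) := by
  refine hasDerivAt_pi.2 fun l ↦ ?_
  simp only [Pi.neg_apply, derivedField, H.head?_string_of_some h]
  split_ifs with hh
  -- Only `a 0` matters: the value `0` gives the function to differentiate, the value `1` its
  -- derivative up to sign.
  · have hprod (a : ℕ → ℕ) (t : ℝ) :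
        ∏ m, signedDividedPow (H.multiIndex l m) (H.multiIndex j m + if m = k then a 0 else 0)
          (Function.update x k t m) =
        signedDividedPow (H.multiIndex l k) (H.multiIndex j k + a 0) t *
          ∏ m ∈ Finset.univ.erase k,
            signedDividedPow (H.multiIndex l m) (H.multiIndex j m) (x m) := by
      rw [← Finset.mul_prod_erase _ _ (Finset.mem_univ k)]
      congr 1
      · simp
      · refine Finset.prod_congr rfl fun m hm ↦ ?_
        have := Finset.ne_of_mem_erase hm
        simp [this]
    have h0 := hprod fun _ ↦ 0
    have h1 := hprod (fun _ ↦ 1) (x k)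
    simp only [ite_self, add_zero] at h0
    rw [Function.update_eq_self] at h1
    simp only [H.multiIndex_of_some h, h0, h1]
    rw [← neg_mul]
    exact (hasDerivAt_signedDividedPow _ _ _).mul_const _
  · simpa using hasDerivAt_const (x k) (0 : ℝ)

variable {X : Fin n → (Fin n → ℝ) → (Fin n → ℝ)}

theorem contDiff_of_origin
    (hgen : ∀ i, H.origin i = none → X i = H.graysonGrossmanField i)
    (hbr : ∀ i j k, H.origin i = some (j, k) → X i = VectorField.lieBracket ℝ (X j) (X k))
    (i : Fin n) : ContDiff ℝ (⊤ : ℕ∞) (X i) := by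
  induction i using WellFoundedLT.induction with
  | ind i ih =>
    cases h : H.origin i with
    | none => exact hgen i h ▸ H.contDiff_graysonGrossmanField i
    | some p =>
      rw [hbr i p.1 p.2 h]
      exact (ih _ (H.left_lt h)).lieBracket_vectorField
        (ih _ ((H.lt_of_origin i _ _ h).trans (H.left_lt h))) (by simp)

/-- The vector field `Xᵢ` is the derived field where the coordinates before its right parent
vanish. -/
theorem apply_eq_derivedField
    (hgen : ∀ i, H.origin i = none → X i = H.graysonGrossmanField i)
    (hbr : ∀ i j k, H.origin i = some (j, k) → X i = VectorField.lieBracket ℝ (X j) (X k))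
    (i : Fin n) (x : Fin n → ℝ) (hx : ∀ j k, H.origin i = some (j, k) → ∀ m < k, x m = 0) :
    X i x = H.derivedField i x := by
  induction i using WellFoundedLT.induction generalizing x with
  | ind i ih =>
    cases h : H.origin i with
    | none => rw [hgen i h, H.graysonGrossmanField_eq_derivedField h]
    | some p =>
      obtain ⟨j, k⟩ := p
      replace hx := hx j k h
      have hkj := H.lt_of_origin i j k h
      -- The right parent of `Xⱼ` is at most `k`, so the vanishing hypothesis passes to `j`.
      have hj : ∀ y : Fin n → ℝ, (∀ m < k, y m = 0) → X j y = H.derivedField j y :=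
        fun y hy ↦ ih j (H.left_lt h) y fun a b hab m hm ↦
          hy m (hm.trans_le (H.le_of_origin i j k h a b hab))
      have hk : ∀ y : Fin n → ℝ, (∀ m < k, y m = 0) → X k y = Pi.single k 1 := by
        intro y hy
        rw [ih k (hkj.trans (H.left_lt h)) y fun a b hab m hm ↦ hy m (hm.trans
          ((H.lt_of_origin k a b hab).trans (H.left_lt hab))), H.derivedField_eq_single hy]
      have hdiff (l : Fin n) : HasFDerivAt (X l) (fderiv ℝ (X l) x) x :=
        ((H.contDiff_of_origin hgen hbr l).differentiable (by simp) x).hasFDerivAt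
      have hline (l : Fin n) (v : Fin n → ℝ) :
          HasDerivAt (fun t : ℝ ↦ X l (x + t • v)) (fderiv ℝ (X l) x v) 0 :=
        (hdiff l).hasLineDerivAt v
      -- Moving along `Xⱼ(x)` leaves the coordinates before `k` at zero, where `Xₖ` is constant.
      have h1 : fderiv ℝ (X k) x (X j x) = 0 := by
        refine (hline k (X j x)).unique ?_
        have : (fun t : ℝ ↦ X k (x + t • X j x)) = fun _ ↦ Pi.single k 1 := by
          funext t
          refine hk _ fun m hm ↦ ?_
          simp [hx m hm, hj x hx, H.derivedField_apply_eq_zero_of_lt (hm.trans hkj)]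
        rw [this]
        exact hasDerivAt_const _ _
      -- Along `∂/∂xₖ` the coordinates before `k` also stay zero, so `Xⱼ` may be replaced by its
      -- derived field.
      have h2 : fderiv ℝ (X j) x (X k x) = -H.derivedField i x := by
        rw [hk x hx]
        refine (hline j (Pi.single k 1)).unique ?_
        have : (fun t : ℝ ↦ X j (x + t • Pi.single k 1)) =
            fun t ↦ H.derivedField j (Function.update x k (x k + t)) := by
          funext t
          have hupd : x + t • Pi.single k 1 = Function.update x k (x k + t) := by
            funext m
            rcases eq_or_ne m k with rfl | hm <;> simp [*]
          rw [hupd]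
          exact hj _ fun m hm ↦ by simp [hm.ne, hx m hm]
        rw [this]
        exact HasDerivAt.comp_const_add (x k) 0 (by simpa using H.hasDerivAt_derivedField h x)
      rw [hbr i j k h, VectorField.lieBracket, h1, h2]
      simp

/-- The vector field `Xᵢ` is `∂/∂xᵢ` where the coordinates before the `i`-th vanish. -/
theorem apply_eq_single
    (hgen : ∀ i, H.origin i = none → X i = H.graysonGrossmanField i)
    (hbr : ∀ i j k, H.origin i = some (j, k) → X i = VectorField.lieBracket ℝ (X j) (X k))
    {i : Fin n} {x : Fin n → ℝ} (hx : ∀ m < i, x m = 0) : X i x = Pi.single i 1 := by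
  rw [H.apply_eq_derivedField hgen hbr i x fun j k h m hm ↦
    hx m (hm.trans ((H.lt_of_origin i j k h).trans (H.left_lt h))), H.derivedField_eq_single hx]

end HallBasis

/-! ### Flows and the exponential mapping. -/

/-- Integral curves of a `C¹` vector field on a compact interval are unique. -/
theorem IsIntegralCurveOn.eqOn_uIcc_of_contDiff {E : Type*} [NormedAddCommGroup E]
    [NormedSpace ℝ E] {V : E → E} (hV : ContDiff ℝ 1 V) {γ γ' : ℝ → E} {t : ℝ}
    (hγ : IsIntegralCurveOn γ (fun _ ↦ V) (Set.uIcc 0 t))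
    (hγ' : IsIntegralCurveOn γ' (fun _ ↦ V) (Set.uIcc 0 t)) (h0 : γ 0 = γ' 0) :
    Set.EqOn γ γ' (Set.uIcc 0 t) := by
  -- The two trajectories form a compact set, on which a `C¹` field has a uniform Lipschitz
  -- constant.
  obtain ⟨K, hK⟩ := hV.locallyLipschitz.locallyLipschitzOn
    (s := γ '' Set.uIcc 0 t ∪ γ' '' Set.uIcc 0 t) |>.exists_lipschitzOnWith_of_compact
    ((isCompact_uIcc.image_of_continuousOn hγ.continuousOn).union
      (isCompact_uIcc.image_of_continuousOn hγ'.continuousOn))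
  have hm : ∀ u ∈ Set.uIcc 0 t, γ u ∈ γ '' Set.uIcc 0 t ∪ γ' '' Set.uIcc 0 t :=
    fun u hu ↦ Or.inl ⟨u, hu, rfl⟩
  have hm' : ∀ u ∈ Set.uIcc 0 t, γ' u ∈ γ '' Set.uIcc 0 t ∪ γ' '' Set.uIcc 0 t :=
    fun u hu ↦ Or.inr ⟨u, hu, rfl⟩
  generalize γ '' Set.uIcc 0 t ∪ γ' '' Set.uIcc 0 t = S at hK hm hm'
  have hc := hγ.continuousOn
  have hc' := hγ'.continuousOn
  rcases le_total 0 t with ht | ht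
  · rw [Set.uIcc_of_le ht] at *
    have hd {δ : ℝ → E} (h : IsIntegralCurveOn δ (fun _ ↦ V) (Set.Icc 0 t)) :
        ∀ u ∈ Set.Ico 0 t, HasDerivWithinAt δ (V (δ u)) (Set.Ici u) u := fun u hu ↦
      (h u (Set.Ico_subset_Icc_self hu)).mono_of_mem_nhdsWithin (Icc_mem_nhdsGE_of_mem hu)
    exact ODE_solution_unique_of_mem_Icc_right (v := fun _ ↦ V) (s := fun _ ↦ S) (fun _ _ ↦ hK)
      hc (hd hγ) (fun u hu ↦ hm u (Set.Ico_subset_Icc_self hu))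
      hc' (hd hγ') (fun u hu ↦ hm' u (Set.Ico_subset_Icc_self hu)) h0
  · rw [Set.uIcc_of_ge ht] at *
    have hd {δ : ℝ → E} (h : IsIntegralCurveOn δ (fun _ ↦ V) (Set.Icc t 0)) :
        ∀ u ∈ Set.Ioc t 0, HasDerivWithinAt δ (V (δ u)) (Set.Iic u) u := fun u hu ↦
      (h u (Set.Ioc_subset_Icc_self hu)).mono_of_mem_nhdsWithin (Icc_mem_nhdsLE_of_mem hu)
    exact ODE_solution_unique_of_mem_Icc_left (v := fun _ ↦ V) (s := fun _ ↦ S) (fun _ _ ↦ hK)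
      hc (hd hγ) (fun u hu ↦ hm u (Set.Ioc_subset_Icc_self hu))
      hc' (hd hγ') (fun u hu ↦ hm' u (Set.Ioc_subset_Icc_self hu)) h0

theorem vectorFieldFlow_eq_some {n : ℕ} {V : (Fin n → ℝ) → (Fin n → ℝ)} (hV : ContDiff ℝ 1 V)
    {t : ℝ} {p q : Fin n → ℝ} (h : FlowsTo V t p q) : vectorFieldFlow V t p = Part.some q := by
  have huniq : ∀ q', FlowsTo V t p q' → q' = q := by
    rintro q' ⟨γ', hγ', h0', rfl⟩
    obtain ⟨γ, hγ, h0, rfl⟩ := h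
    exact hγ'.eqOn_uIcc_of_contDiff hV hγ (h0'.trans h0.symm) Set.right_mem_uIcc
  have hdom : ∃! q, FlowsTo V t p q := ⟨q, h, huniq⟩
  exact Part.eq_some_iff.2 ⟨hdom, huniq _ hdom.exists.choose_spec⟩

/-- Straight lines along which the vector field is constant are integral curves. -/
theorem flowsTo_add_smul {n : ℕ} {V : (Fin n → ℝ) → (Fin n → ℝ)} {p v : Fin n → ℝ}
    (h : ∀ u : ℝ, V (p + u • v) = v) (t : ℝ) : FlowsTo V t p (p + t • v) := by
  refine ⟨fun u ↦ p + u • v, fun u _ ↦ ?_, by simp, rfl⟩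
  simp only [h]
  simpa using (((hasDerivAt_id u).smul_const v).const_add p).hasDerivWithinAt

theorem Fin.foldr_eq_of_forall {α : Type*} {n : ℕ} (f : Fin n → α → α) (a : ℕ → α)
    (h : ∀ i : Fin n, f i (a (i + 1)) = a i) : Fin.foldr n f (a n) = a 0 := by
  induction n with
  | zero => simp
  | succ n ih =>
    have hn := h (Fin.last n)
    rw [Fin.val_last] at hn
    rw [Fin.foldr_succ_last, hn]
    exact ih _ fun i ↦ h i.castSucc

/-- For a Hall–Grayson–Grossman basis of vector fields on `ℝⁿ`, the exponential mapping of the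
second type is defined on all of `ℝⁿ` and is the identity. -/
theorem mainTheorem9 (s r n : ℕ) (X : Fin n → (Fin n → ℝ) → (Fin n → ℝ))
    (hX : IsHallGraysonGrossmanBasis s r X) (x : Fin n → ℝ) :
    secondTypeExp X x = Part.some x := by
  obtain ⟨H, hgen, hbr⟩ := hX
  -- The point reached once all flows with index `≥ k` have acted.
  let p (k : ℕ) (m : Fin n) : ℝ := if k ≤ m then x m else 0
  have hpn : p n = 0 := funext fun m ↦ if_neg (by omega)
  have hp0 : p 0 = x := funext fun m ↦ if_pos (Nat.zero_le _)
  have hp (i : Fin n) : p i = p (i + 1) + x i • Pi.single i 1 := by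
    funext m
    rcases lt_trichotomy m i with h | rfl | h
    · simp [p, h.ne, h.not_ge, h.not_gt]
    · simp [p]
    · simp [p, h.ne', h, h.le]
  have key := Fin.foldr_eq_of_forall
    (fun i (P : Part (Fin n → ℝ)) ↦ P.bind (vectorFieldFlow (X i) (x i)))
    (fun k ↦ Part.some (p k)) fun i ↦ by
      rw [Part.bind_some, hp i]
      refine vectorFieldFlow_eq_some ((H.contDiff_of_origin hgen hbr i).of_le (by simp))
        (flowsTo_add_smul (fun u ↦ H.apply_eq_single hgen hbr fun m hm ↦ ?_) (x i))
      simp [p, hm.ne, hm.not_gt]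
  simp only [hpn, hp0] at key
  exact key
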